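/- **Proposition 2 (lower bound on message complexity for dense graphs).** *Networks.* For $n\ge 1$ let $\mathcal G_d(n)$ be the set of connected undirected graphs $G=(V,E)$ on $V=\{1,\dots,n\}$ with $|E|\ge n\log n$. Every node of $G$ runs the same algorithm, an arbitrary (nondeterministic) input/output automaton with finitely many tasks and with no bound on the size of its states and messages. A node starts with its unique identifier $i\in V$, its number of ports $\deg i$ and its initial value $x_i$. It addresses its neighbours individually through ports numbered $0,\dots,\deg i-1$, and does not initially know which neighbour lies behind which port. Links are reliable and first-in first-out. Execution is asynchronous: for fixed constants $l,d>0$, an execution is fair if every enabled task performs a transition (or ceases to be enabled) within $l$ time units and every message is delivered within $d$ time units of being sent. *Consensus functions.* Let $\mathcal X$ be a nonempty totally ordered set. A consensus function is a function $f$ on $\mathcal X^n$ such that for every $x\in\mathcal X^n$ and every $i$ there are two values of the $i$-th argument which, substituted for $x_i$, give different values of $f$. It is *locally sensitive* if for each permutation $\sigma$ of $\{1,\dots,n\}$ there is $x\in\mathcal X^n$ with $x_{\sigma(i)}\le x_{\sigma(j)}$ for all $i<j$ such that for every $i$ there are $a\ne b$ in $\mathcal X$ with $a,b\le x_{\sigma(j)}$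 for all $j>i$ and $x_{\sigma(j)}\le a,b$ for all $j<i$, for which replacing $x_{\sigma(i)}$ by $a$ and by $b$ gives different values of $f$. It is *extractive* if for every $x$ one has $f(x)=x_j$ for some $j$ (elements of $\mathcal X$ being identified with elements of the codomain of $f$ through an injection). *Complexity.* An algorithm computes $f$ on $\mathcal G_d(n)$ if for some $R$, for all $G\in\mathcal G_d(n)$, all port numberings, all $x\in\mathcal X^n$ and all fair executions, every node has output $f(x)$ and stopped by time $R(l+d)$. The message complexity $\mathrm{MC}(f,\mathcal G_d(n))$ is the infimum, over all algorithms that compute $f$ on $\mathcal G_d(n)$, of the supremum, over all $G\in\mathcal G_d(n)$, port numberings, $x\in\mathcal X^n$ and fair executions, of the number of messages sent until all nodes have stopped. *Claim.* For locally sensitive or extractive consensus functions, $\mathrm{MC}(f,\mathcal G_d)\in\Omega(|E|)$. That is, there are absolute constants $c>0$ and $N$ such that for all $n\ge N$, all nonempty totally ordered sets $\mathcal X$, all locally sensitive or extractive consensus functions $f$ on $\mathcal X^n$ and all $l,d>0$, $$\mathrm{MC}(f,\mathcal G_d(n))\ \ge\ c\,|E(G)|\qquad\text{for every } G\in\mathcal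 G_d(n).$$ -/

import Mathlib

open scoped NNReal ENNReal

universe u v w

namespace DistributedConsensus

/-! ### Consensus functions -/

/-- A consensus function depends on each of its arguments, at every point. The codomain is an
arbitrary type `Y` (for instance `ℝ`). -/
def IsConsensus {n : ℕ} {X : Type u} {Y : Type v} (f : (Fin n → X) → Y) : Prop :=
  ∀ (x : Fin n → X) (i : Fin n), ∃ a b : X,
    f (Function.update x i a) ≠ f (Function.update x i b)

/-- A consensus function that is sensitive to order-preserving perturbations of one argument. -/
def IsLocallySensitive {n : ℕ} {X : Type u} [LinearOrder X] {Y : Type v}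
    (f : (Fin n → X) → Y) : Prop :=
  IsConsensus f ∧
  ∀ σ : Equiv.Perm (Fin n), ∃ x : Fin n → X,
    (∀ i j, i < j → x (σ i) ≤ x (σ j)) ∧
    ∀ i, ∃ a b : X, a ≠ b ∧
      (∀ j, i < j → a ≤ x (σ j) ∧ b ≤ x (σ j)) ∧
      (∀ j, j < i → x (σ j) ≤ a ∧ x (σ j) ≤ b) ∧
      f (Function.update x (σ i) a) ≠ f (Function.update x (σ i) b)

/-- A consensus function whose value is always one of its arguments. The embedding `ι` identifies
the initial values with elements of the codomain (it is the identity if `Y = X`, and the inclusion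
if `X ⊆ ℝ = Y`). -/
def IsExtractive {n : ℕ} {X : Type u} {Y : Type v} (f : (Fin n → X) → Y) : Prop :=
  IsConsensus f ∧ ∃ ι : X ↪ Y, ∀ x, ∃ j, f x = ι (x j)

/-! ### Networks -/

/-- Dense networks on the node set `Fin n`: connected graphs with at least `n log n` edges. -/
def denseGraphs (n : ℕ) : Set (SimpleGraph (Fin n)) :=
  {G | G.Connected ∧ (n : ℝ) * Real.log n ≤ G.edgeSet.ncard}

/-- A numbering of the communication ports of every node. Node `v` has one port for each of its
neighbours, numbered `0, …, deg v - 1`, and `port v w` is the number of the port of `v` that leads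
to its neighbour `w` (the value is irrelevant if `w` is not a neighbour of `v`). A node sees port
numbers only, not the identities of the nodes behind them. -/
structure PortNumbering {n : ℕ} (G : SimpleGraph (Fin n)) where
  port : Fin n → Fin n → ℕ
  bijOn : ∀ v, Set.BijOn (port v) (G.neighborSet v) (Set.Iio (G.neighborSet v).ncard)

/-! ### Algorithms -/

/-- A distributed algorithm for `n` nodes: the (nondeterministic) input/output automaton that every
node runs. Nodes differ only in their start states, which are determined by the identifier of the
node, by its number of ports, and by its initial value. There is no bound on the size of states and
messages, and no restriction on the transitions. -/
structure Algorithm (n : ℕ) (X : Type u) (Y : Type v) where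
  /-- Local states. -/
  State : Type w
  /-- Contents of messages. -/
  Msg : Type w
  /-- The locally controlled transitions are grouped into finitely many tasks `Fin tasks`. -/
  tasks : ℕ
  /-- `start i k x`: the possible start states of the node with identifier `i`, with `k` ports
  and with initial value `x`. -/
  start : Fin n → ℕ → X → Set State
  start_nonempty : ∀ i k x, (start i k x).Nonempty
  /-- `step τ s out s'`: in state `s` the task `τ` can make a transition to `s'`, which is internal
  if `out = none` and sends the message `m` through port `p` if `out = some (p, m)`. -/
  step : Fin tasks → State → Option (ℕ × Msg) → State → Prop
  /-- `recv p m s s'`: receipt of `m` at port `p` in state `s` may lead to state `s'`. -/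
  recv : ℕ → Msg → State → State → Prop
  /-- Automata are input-enabled: receipt of a message is never refused. -/
  recv_total : ∀ p m s, ∃ s', recv p m s s'
  /-- `result s = some y`: the node has output `y` and has stopped. -/
  result : State → Option Y
  /-- A stopped node makes no transition of its own, and in particular sends nothing. -/
  step_of_stopped : ∀ τ s out s', (result s).isSome → ¬ step τ s out s'
  /-- A stopped node that receives a message remains stopped, with the same output. -/
  recv_of_stopped : ∀ p m s s' y, result s = some y → recv p m s s' → result s' = some y

/-! ### Executions -/

/-- A global configuration: the state of each node, and for each ordered pair `(a, b)` of nodes the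
queue of the messages in transit from `a` to `b`, oldest first. -/
structure Config {n : ℕ} {X : Type u} {Y : Type v} (A : Algorithm.{u, v, w} n X Y) where
  state : Fin n → A.State
  chan : Fin n → Fin n → List A.Msg

/-- Events of an execution. -/
inductive Event {n : ℕ} {X : Type u} {Y : Type v} (A : Algorithm.{u, v, w} n X Y) where
  /-- Nothing happens (time passes). -/
  | idle
  /-- The oldest message in transit from `a` to `b` is delivered to `b`. -/
  | deliver (a b : Fin n)
  /-- The task `τ` of node `a` makes a transition, with the given output. -/
  | act (a : Fin n) (τ : Fin A.tasks) (out : Option (ℕ × A.Msg))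

section

variable {n : ℕ} {X : Type u} {Y : Type v} {A : Algorithm.{u, v, w} n X Y}
  {G : SimpleGraph (Fin n)}

/-- The messages (at most one) that an output of node `a` puts on the link from `a` to `b`. -/
noncomputable def emitted (P : PortNumbering G) (a b : Fin n) :
    Option (ℕ × A.Msg) → List A.Msg
  | none => []
  | some (p, m) => open scoped Classical in if G.Adj a b ∧ P.port a b = p then [m] else []

/-- `Step P c e c'`: the event `e` can lead from the configuration `c` to `c'`. -/
def Step (P : PortNumbering G) (c : Config A) (e : Event A) (c' : Config A) : Prop :=
  match e with
  | .idle => c' = c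
  | .deliver a b => ∃ (m : A.Msg) (rest : List A.Msg) (s : A.State),
      c.chan a b = m :: rest ∧ A.recv (P.port b a) m (c.state b) s ∧
      c'.state = Function.update c.state b s ∧
      c'.chan = Function.update c.chan a (Function.update (c.chan a) b rest)
  | .act a τ out => ∃ s : A.State,
      A.step τ (c.state a) out s ∧
      c'.state = Function.update c.state a s ∧
      c'.chan = Function.update c.chan a (fun b => c.chan a b ++ emitted P a b out)

/-- The task `τ` of node `a` is enabled in the configuration `c`. -/
def Enabled (c : Config A) (a : Fin n) (τ : Fin A.tasks) : Prop :=
  ∃ out s, A.step τ (c.state a) out s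

/-- All nodes have stopped. -/
def AllStopped (c : Config A) : Prop := ∀ a, (A.result (c.state a)).isSome

end

/-- A timed run: `config k` is the configuration after the first `k` events, it is reached at time
`time k`, and `event k` leads from `config k` to `config (k + 1)`. Executions with finitely many
events are continued with idle events. -/
structure Run {n : ℕ} {X : Type u} {Y : Type v} (A : Algorithm.{u, v, w} n X Y) where
  config : ℕ → Config A
  event : ℕ → Event A
  time : ℕ → ℝ

namespace Run

variable {n : ℕ} {X : Type u} {Y : Type v} {A : Algorithm.{u, v, w} n X Y}
  {G : SimpleGraph (Fin n)}

/-- Number of messages sent from `a` to its neighbour `b` during the first `k` events. -/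
noncomputable def sent (α : Run A) (P : PortNumbering G) (a b : Fin n) (k : ℕ) : ℕ :=
  {i | i < k ∧ ∃ τ p m, α.event i = .act a τ (some (p, m)) ∧ G.Adj a b ∧ P.port a b = p}.ncard

/-- Number of messages from `a` delivered to `b` during the first `k` events. -/
noncomputable def delivered (α : Run A) (a b : Fin n) (k : ℕ) : ℕ :=
  {i | i < k ∧ α.event i = .deliver a b}.ncard

/-- Number of messages sent in the whole network during the first `k` events. -/
noncomputable def totalSent (α : Run A) (P : PortNumbering G) (k : ℕ) : ℕ :=
  ∑ a, ∑ b, α.sent P a b k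

/-- The number of messages sent up to the first moment at which all nodes have stopped. -/
noncomputable def messageCount (α : Run A) (P : PortNumbering G) : ℕ∞ :=
  ⨆ k ∈ {k : ℕ | ∀ j < k, ¬ AllStopped (α.config j)}, (α.totalSent P k : ℕ∞)

/-- Fair executions with initial values `x`, in the network `G` with port numbering `P`. -/
structure IsFair (α : Run A) (P : PortNumbering G) (x : Fin n → X) (l d : ℝ) : Prop where
  /-- Every node is in a start state. -/
  start : ∀ a, (α.config 0).state a ∈ A.start a (G.neighborSet a).ncard (x a)
  /-- No message is in transit at the beginning. -/
  chan_empty : ∀ a b, (α.config 0).chan a b = []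
  step : ∀ k, Step P (α.config k) (α.event k) (α.config (k + 1))
  time_zero : α.time 0 = 0
  time_mono : Monotone α.time
  time_unbounded : Filter.Tendsto α.time Filter.atTop Filter.atTop
  /-- An enabled task makes a transition, or stops being enabled, within `l` time units. -/
  task_bound : ∀ k a τ, ∃ j ≥ k,
    (¬ Enabled (α.config j) a τ ∧ α.time j ≤ α.time k + l) ∨
    ((∃ out, α.event j = .act a τ out) ∧ α.time (j + 1) ≤ α.time k + l)
  /-- Every message is delivered within `d` time units. Links are first-in first-out. -/
  message_bound : ∀ k a b, ∃ j,
    α.time j ≤ α.time k + d ∧ α.sent P a b k ≤ α.delivered a b j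

end Run

/-! ### Message complexity -/

/-- The algorithm computes `f` on the class `𝒢`: for some `R`, in every network of the class, for
all initial values, and in every fair execution, all nodes have output the value of `f` and have
stopped by time `R (l + d)`. -/
def Computes {n : ℕ} {X : Type u} {Y : Type v} (A : Algorithm.{u, v, w} n X Y) (l d : ℝ)
    (f : (Fin n → X) → Y) (𝒢 : Set (SimpleGraph (Fin n))) : Prop :=
  ∃ R : ℕ, ∀ G ∈ 𝒢, ∀ (P : PortNumbering G) (x : Fin n → X) (α : Run A), α.IsFair P x l d →
    ∃ k, α.time k ≤ R * (l + d) ∧ ∀ a, A.result ((α.config k).state a) = some (f x)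

/-- The message complexity of `f` on the class `𝒢`: the infimum over all algorithms that compute
`f`, of the supremum over networks, initial values, and fair executions, of the number of messages
sent until all nodes have stopped. -/
noncomputable def messageComplexity {n : ℕ} {X : Type u} {Y : Type v} (l d : ℝ)
    (f : (Fin n → X) → Y) (𝒢 : Set (SimpleGraph (Fin n))) : ℕ∞ :=
  ⨅ (A : Algorithm.{u, v, w} n X Y) (_ : Computes A l d f 𝒢),
    ⨆ (G ∈ 𝒢) (P : PortNumbering G) (x : Fin n → X) (α : Run A) (_ : α.IsFair P x l d),
      α.messageCount P

end DistributedConsensus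

/-! Let a scheduler that resolves all nondeterminism by fixed choices run the algorithm on a network
outside the class: two disjoint cliques on about `n / 2` nodes each. If each clique has an edge over
which nothing has been sent up to time `K`, the two edges can be replaced by two edges between the
cliques, attached to the same ports. No node can tell the difference up to `K`
(`Switching.sched_config_ports`), and the new network is connected and dense
(`cliqueSwitching_mem_denseGraphs`).

For some input, one clique eventually has all its edges used (`exists_covered_of_computes`).
Otherwise, for every `x`, a switch that is never noticed shows that the run on the two cliques
outputs `f x`. The two sides run independently (`sched_twoCliques_congr`), so `f` would be
determined by the values on either side alone, whereas it depends on every argument.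

Stop just before the first clique is covered (`exists_many_of_covered`). Almost all edges of that
clique have carried a message, which is quadratically many, yet both cliques still have an unused
edge. Switching there turns this into a run in a network of the class with equally many messages.
Since `|E| ≤ n ^ 2 / 2`, the bound follows. -/

namespace DistributedConsensus

variable {n : ℕ} {X : Type u} {Y : Type v} {A : Algorithm.{u, v, w} n X Y}
  {G : SimpleGraph (Fin n)}

/-! ### Counting messages -/

/-- The event puts a message on the link from `a` to `b`. -/
def Event.Sends (P : PortNumbering G) (a b : Fin n) (e : Event A) : Prop :=
  ∃ τ p m, e = .act a τ (some (p, m)) ∧ G.Adj a b ∧ P.port a b = p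

theorem ncard_lt_and_eq_count (p : ℕ → Prop) [DecidablePred p] (k : ℕ) :
    {i | i < k ∧ p i}.ncard = Nat.count p k := by
  rw [Nat.count_eq_card_filter_range, ← Set.ncard_coe_finset]
  congr 1
  ext i
  simp

namespace Run

variable (α : Run A) (P : PortNumbering G) (a b : Fin n) (k : ℕ)

open scoped Classical in
theorem sent_eq_count : α.sent P a b k = Nat.count (fun i => (α.event i).Sends P a b) k := by
  rw [← ncard_lt_and_eq_count]
  rfl

open scoped Classical in
theorem delivered_eq_count :
    α.delivered a b k = Nat.count (fun i => α.event i = .deliver a b) k := by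
  rw [← ncard_lt_and_eq_count]
  rfl

theorem sent_zero : α.sent P a b 0 = 0 := by
  classical
  simp [sent_eq_count]

open scoped Classical in
theorem sent_succ :
    α.sent P a b (k + 1) = α.sent P a b k + if (α.event k).Sends P a b then 1 else 0 := by
  simp only [sent_eq_count, Nat.count_succ]

open scoped Classical in
theorem delivered_succ :
    α.delivered a b (k + 1) =
      α.delivered a b k + if α.event k = .deliver a b then 1 else 0 := by
  simp only [delivered_eq_count, Nat.count_succ]

theorem sent_mono : Monotone (α.sent P a b) := fun i j h => by
  classical
  simpa only [sent_eq_count] using Nat.count_monotone _ h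

theorem delivered_mono : Monotone (α.delivered a b) := fun i j h => by
  classical
  simpa only [delivered_eq_count] using Nat.count_monotone _ h

variable {α P a b k}

theorem sent_eq_zero_of_not_adj (h : ¬ G.Adj a b) : α.sent P a b k = 0 := by
  have : {i | i < k ∧ ∃ τ p m, α.event i = .act a τ (some (p, m)) ∧ G.Adj a b ∧
      P.port a b = p} = ∅ := by
    ext i
    simp [h]
  rw [sent, this, Set.ncard_empty]

theorem sent_eq_zero_iff : α.sent P a b k = 0 ↔ ∀ i < k, ¬ (α.event i).Sends P a b := by
  classical
  rw [sent_eq_count, Nat.count_iff_forall_not]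

/-- Every message sent is either delivered or in transit. -/
theorem sent_eq_delivered_add (hc : ∀ a b, (α.config 0).chan a b = [])
    (hs : ∀ k, Step P (α.config k) (α.event k) (α.config (k + 1))) (k : ℕ) (a b : Fin n) :
    α.sent P a b k = α.delivered a b k + ((α.config k).chan a b).length := by
  classical
  induction k with
  | zero => simp [sent, delivered, hc]
  | succ k ih =>
    have h := hs k
    rw [sent_succ, delivered_succ, ih]
    rcases he : α.event k with _ | ⟨a', b'⟩ | ⟨a', τ, _ | ⟨p, m⟩⟩ <;>
      simp only [he, Step] at h
    · simp [Event.Sends, h]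
    · obtain ⟨m, rest, s, hm, -, -, h⟩ := h
      rw [h]
      by_cases haa : a = a'
      · subst haa
        by_cases hbb : b = b'
        · subst hbb
          simp [Event.Sends, hm]
          omega
        · simp [Event.Sends, hbb, Ne.symm hbb]
      · simp [Event.Sends, haa, Ne.symm haa]
    · obtain ⟨s, -, -, h⟩ := h
      rw [h]
      by_cases haa : a = a'
      · subst haa
        simp [Event.Sends, emitted]
      · simp [Event.Sends, haa]
    · obtain ⟨s, -, -, h⟩ := h
      rw [h]
      by_cases haa : a = a'
      · subst haa
        by_cases hp : G.Adj a b ∧ P.port a b = p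
        · simp [Event.Sends, emitted, hp]
          omega
        · simp only [Event.Sends, emitted, hp, Function.update_self]
          simpa using fun h₁ h₂ => hp ⟨h₂, h₁.symm⟩
      · simp [Event.Sends, haa, Ne.symm haa]

theorem chan_eq_nil_of_sent_eq_zero (hc : ∀ a b, (α.config 0).chan a b = [])
    (hs : ∀ k, Step P (α.config k) (α.event k) (α.config (k + 1)))
    (h : α.sent P a b k = 0) : (α.config k).chan a b = [] := by
  have := sent_eq_delivered_add hc hs k a b
  exact List.length_eq_zero_iff.1 (by omega)

/-- Being stopped is absorbing, so outputs observed at different times, or in different runs, can be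
compared at a common later time. -/
theorem result_mono (hs : ∀ k, Step P (α.config k) (α.event k) (α.config (k + 1)))
    {j k : ℕ} (hjk : j ≤ k) {y : Y} (h : A.result ((α.config j).state a) = some y) :
    A.result ((α.config k).state a) = some y := by
  induction k, hjk using Nat.le_induction with
  | base => exact h
  | succ k _ ih =>
    have hk := hs k
    rcases he : α.event k with _ | ⟨a', b'⟩ | ⟨a', τ, out⟩ <;> simp only [he, Step] at hk
    · rwa [hk]
    · obtain ⟨m, rest, s, -, hr, hst, -⟩ := hk
      rw [hst]
      by_cases hab : a = b'
      · subst hab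
        simpa using A.recv_of_stopped _ _ _ _ _ ih hr
      · simpa [hab] using ih
    · obtain ⟨s, hr, hst, -⟩ := hk
      rw [hst]
      by_cases hab : a = a'
      · subst hab
        exact absurd hr (A.step_of_stopped _ _ _ _ (by simp [ih]))
      · simpa [hab] using ih

end Run

/-! ### Timing -/

/-- A strictly increasing sequence of natural numbers, read as a sequence of deadlines, gives
a clock that advances by one at each deadline. -/
theorem exists_clock (B : ℕ → ℕ) (hB : ∀ k, k < B k) :
    ∃ φ : ℕ → ℕ, φ 0 = 0 ∧ Monotone φ ∧ Filter.Tendsto φ Filter.atTop Filter.atTop ∧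
      ∀ k, ∃ k' ≥ k, φ (B k') ≤ φ k + 2 := by
  let t : ℕ → ℕ := fun i => B^[i] 0
  have ht : ∀ i, t (i + 1) = B (t i) := fun i => Function.iterate_succ_apply' B i 0
  have hmono : StrictMono t := strictMono_nat_of_lt_succ fun i => by
    rw [ht]
    exact hB _
  have hex : ∀ k, ∃ i, k < t (i + 1) := fun k =>
    ⟨k, lt_of_lt_of_le (Nat.lt_succ_self k) (hmono.le_apply (x := k + 1))⟩
  classical
  have hφ : Monotone fun k => Nat.find (hex k) := fun j k hjk =>
    Nat.find_mono fun i hi => lt_of_le_of_lt hjk hi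
  refine ⟨fun k => Nat.find (hex k), ?_, hφ, ?_, fun k => ?_⟩
  · refine (Nat.find_eq_zero _).2 ?_
    rw [ht]
    exact lt_of_le_of_lt (Nat.zero_le _) (hB _)
  · refine Filter.tendsto_atTop_atTop_of_monotone hφ fun i => ⟨t i, ?_⟩
    refine (Nat.le_find_iff _ _).2 fun j hj => not_lt.2 (hmono.monotone hj)
  -- The witness `k'` is the first tick after `k`; its deadline `B k'` is the tick after that, so
  -- only two ticks separate `k` from `B k'`.
  · refine ⟨t (Nat.find (hex k) + 1), (Nat.find_spec (hex k)).le, ?_⟩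
    refine Nat.find_min' _ ?_
    rw [← ht]
    exact hmono (Nat.lt_succ_self _)

/-- An execution that is fair without time bounds can be timed so as to be fair. -/
theorem exists_isFair {config : ℕ → Config A} {event : ℕ → Event A} {P : PortNumbering G}
    {x : Fin n → X} {l d : ℝ} (hl : 0 < l) (hd : 0 < d)
    (start : ∀ a, (config 0).state a ∈ A.start a (G.neighborSet a).ncard (x a))
    (chan_empty : ∀ a b, (config 0).chan a b = [])
    (step : ∀ k, Step P (config k) (event k) (config (k + 1)))
    (task : ∀ k a τ, ∃ j ≥ k, ¬ Enabled (config j) a τ ∨ ∃ out, event j = .act a τ out)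
    (message : ∀ k a b, ∃ j,
      Run.sent ⟨config, event, 0⟩ P a b k ≤ Run.delivered ⟨config, event, 0⟩ a b j) :
    ∃ time, Run.IsFair ⟨config, event, time⟩ P x l d := by
  choose J hJ hJ' using task
  choose L hL using message
  -- The sums serve as an upper bound for all the finitely many obligations arising at `k`.
  let B : ℕ → ℕ := fun k => k + 1 + (∑ a, ∑ τ, (J k a τ + 1)) + ∑ a, ∑ b, L k a b
  have hBJ : ∀ k a τ, J k a τ + 1 ≤ B k := fun k a τ => by
    have h1 : J k a τ + 1 ≤ ∑ τ, (J k a τ + 1) :=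
      Finset.single_le_sum (f := fun τ => J k a τ + 1) (fun _ _ => Nat.zero_le _)
        (Finset.mem_univ τ)
    have h2 : ∑ τ, (J k a τ + 1) ≤ ∑ a, ∑ τ, (J k a τ + 1) :=
      Finset.single_le_sum (f := fun a => ∑ τ, (J k a τ + 1)) (fun _ _ => Nat.zero_le _)
        (Finset.mem_univ a)
    simp only [B]
    omega
  have hBL : ∀ k a b, L k a b ≤ B k := fun k a b => by
    have h1 : L k a b ≤ ∑ b, L k a b :=
      Finset.single_le_sum (fun _ _ => Nat.zero_le _) (Finset.mem_univ b)
    have h2 : ∑ b, L k a b ≤ ∑ a, ∑ b, L k a b :=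
      Finset.single_le_sum (f := fun a => ∑ b, L k a b) (fun _ _ => Nat.zero_le _)
        (Finset.mem_univ a)
    simp only [B]
    omega
  obtain ⟨φ, h0, hmono, htop, hφ⟩ := exists_clock B fun k => by
    simp only [B]
    omega
  -- One tick lasts `min l d / 2`, so the two ticks allowed by `hφ` fit within both `l` and `d`.
  have hε : 0 < min l d / 2 := by positivity
  have key : ∀ j k k', j ≤ B k' → φ (B k') ≤ φ k + 2 →
      min l d / 2 * φ j ≤ min l d / 2 * φ k + min l d := fun j k k' hj hk => by
    have h : (φ j : ℝ) ≤ φ k + 2 := by exact_mod_cast (hmono hj).trans hk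
    nlinarith
  refine ⟨fun k => min l d / 2 * φ k, start, chan_empty, step, by simp [h0], ?_, ?_, ?_, ?_⟩
  · exact fun j k hjk => mul_le_mul_of_nonneg_left (by exact_mod_cast hmono hjk) hε.le
  · exact (tendsto_natCast_atTop_atTop.comp htop).const_mul_atTop hε
  · intro k a τ
    obtain ⟨k', hkk', hk'⟩ := hφ k
    refine ⟨J k' a τ, hkk'.trans (hJ k' a τ), ?_⟩
    have hl' := min_le_left l d
    refine (hJ' k' a τ).imp (fun h => ⟨h, ?_⟩) (fun h => ⟨h, ?_⟩)
    · have := key (J k' a τ) k k' ((Nat.le_succ _).trans (hBJ k' a τ)) hk'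
      simp only
      linarith
    · have := key (J k' a τ + 1) k k' (hBJ k' a τ) hk'
      simp only
      linarith
  · intro k a b
    obtain ⟨k', hkk', hk'⟩ := hφ k
    refine ⟨L k' a b, ?_, ?_⟩
    · have := key (L k' a b) k k' (hBL k' a b) hk'
      have hd' := min_le_right l d
      simp only
      linarith
    · exact (Run.sent_mono ⟨config, event, 0⟩ P a b hkk').trans (hL k' a b)

/-! ### A deterministic scheduler -/

/-- A transition of the task `τ` in the state `s`, if there is one. -/
noncomputable def Algorithm.pick (A : Algorithm.{u, v, w} n X Y) (τ : Fin A.tasks) (s : A.State) :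
    Option (Option (ℕ × A.Msg) × A.State) :=
  open scoped Classical in
  if h : ∃ q : Option (ℕ × A.Msg) × A.State, A.step τ s q.1 q.2 then some h.choose else none

theorem Algorithm.step_of_pick {τ : Fin A.tasks} {s : A.State}
    {q : Option (ℕ × A.Msg) × A.State} (h : A.pick τ s = some q) : A.step τ s q.1 q.2 := by
  unfold Algorithm.pick at h
  split_ifs at h with hq
  rw [← Option.some.inj h]
  exact hq.choose_spec

theorem Algorithm.not_step_of_pick {τ : Fin A.tasks} {s : A.State} (h : A.pick τ s = none)
    (out : Option (ℕ × A.Msg)) (s' : A.State) : ¬ A.step τ s out s' := by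
  unfold Algorithm.pick at h
  split_ifs at h with hq
  exact fun hs => hq ⟨(out, s'), hs⟩

/-- The opportunities offered to the network: delivering the oldest message of a link, or executing
a task of a node. -/
abbrev Slot (A : Algorithm.{u, v, w} n X Y) : Type := (Fin n × Fin n) ⊕ (Fin n × Fin A.tasks)

/-- A sequence in which every slot occurs infinitely often. -/
def slotAt (A : Algorithm.{u, v, w} n X Y) (k : ℕ) : Option (Slot A) :=
  Encodable.decode k.unpair.1

theorem exists_slotAt_eq (s : Slot A) (k : ℕ) : ∃ j ≥ k, slotAt A j = some s :=
  ⟨Nat.pair (Encodable.encode s) k, Nat.right_le_pair _ _, by simp [slotAt]⟩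

/-- The event and the configuration that follow when a slot is offered. -/
noncomputable def advance (P : PortNumbering G) (c : Config A) :
    Option (Slot A) → Event A × Config A
  | none => (.idle, c)
  | some (.inl (a, b)) =>
    match c.chan a b with
    | [] => (.idle, c)
    | m :: rest => (.deliver a b,
        ⟨Function.update c.state b (A.recv_total (P.port b a) m (c.state b)).choose,
          Function.update c.chan a (Function.update (c.chan a) b rest)⟩)
  | some (.inr (a, τ)) =>
    match A.pick τ (c.state a) with
    | none => (.idle, c)
    | some (out, s) => (.act a τ out,
        ⟨Function.update c.state a s,
          Function.update c.chan a (fun b => c.chan a b ++ emitted P a b out)⟩)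

theorem step_advance (P : PortNumbering G) (c : Config A) (o : Option (Slot A)) :
    Step P c (advance P c o).1 (advance P c o).2 := by
  rcases o with _ | ⟨a, b⟩ | ⟨a, τ⟩
  · rfl
  · rcases h : c.chan a b with _ | ⟨m, rest⟩
    · simp [advance, h, Step]
    · simp only [advance, h, Step]
      refine ⟨m, rest, _, ?_, (A.recv_total (P.port b a) m (c.state b)).choose_spec, rfl, ?_⟩ <;>
        trivial
  · rcases h : A.pick τ (c.state a) with _ | ⟨out, s⟩
    · simp [advance, h, Step]
    · simp only [advance, h, Step]
      exact ⟨s, A.step_of_pick h, rfl, trivial⟩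

/-- The chosen initial configuration when node `a` has `deg a` ports. -/
noncomputable def initialConfig (A : Algorithm.{u, v, w} n X Y) (deg : Fin n → ℕ)
    (x : Fin n → X) : Config A :=
  ⟨fun a => (A.start_nonempty a (deg a) (x a)).choose, fun _ _ => []⟩

/-- The configurations of the run produced by the scheduler. -/
noncomputable def schedConfig (A : Algorithm.{u, v, w} n X Y) (P : PortNumbering G)
    (x : Fin n → X) : ℕ → Config A
  | 0 => initialConfig A (fun a => (G.neighborSet a).ncard) x
  | k + 1 => (advance P (schedConfig A P x k) (slotAt A k)).2

/-- The (untimed) run produced by the scheduler. -/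
noncomputable def sched (A : Algorithm.{u, v, w} n X Y) (P : PortNumbering G)
    (x : Fin n → X) : Run A :=
  ⟨schedConfig A P x, fun k => (advance P (schedConfig A P x k) (slotAt A k)).1, 0⟩

variable (A) (P : PortNumbering G) (x : Fin n → X)

theorem sched_chan_zero (a b : Fin n) : ((sched A P x).config 0).chan a b = [] := rfl

theorem sched_config_succ (k : ℕ) : (sched A P x).config (k + 1) =
    (advance P ((sched A P x).config k) (slotAt A k)).2 := rfl

theorem sched_event (k : ℕ) : (sched A P x).event k =
    (advance P ((sched A P x).config k) (slotAt A k)).1 := rfl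

theorem sched_step (k : ℕ) :
    Step P ((sched A P x).config k) ((sched A P x).event k) ((sched A P x).config (k + 1)) :=
  step_advance P _ _

theorem sched_task (k : ℕ) (a : Fin n) (τ : Fin A.tasks) :
    ∃ j ≥ k, ¬ Enabled ((sched A P x).config j) a τ ∨
      ∃ out, (sched A P x).event j = .act a τ out := by
  obtain ⟨j, hj, hs⟩ := exists_slotAt_eq (A := A) (.inr (a, τ)) k
  refine ⟨j, hj, ?_⟩
  rw [sched_event, hs]
  rcases h : A.pick τ (((sched A P x).config j).state a) with _ | ⟨out, s⟩
  · exact .inl fun ⟨out, s, hst⟩ => A.not_step_of_pick h out s hst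
  · exact .inr ⟨out, by simp [advance, h]⟩

/-- If the messages sent by time `k` were never all delivered, the link would be nonempty whenever
its slot is offered after `k`. Each such offer delivers a message, so the number of deliveries would
be unbounded. -/
theorem sched_message (k : ℕ) (a b : Fin n) :
    ∃ j, (sched A P x).sent P a b k ≤ (sched A P x).delivered a b j := by
  by_contra! hlt
  have hgrow : ∀ N, ∃ j, N ≤ (sched A P x).delivered a b j := fun N => by
    induction N with
    | zero => exact ⟨0, Nat.zero_le _⟩
    | succ N ih =>
      obtain ⟨i, hi⟩ := ih
      obtain ⟨j, hj, hs⟩ := exists_slotAt_eq (A := A) (.inl (a, b)) (max i k)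
      refine ⟨j + 1, ?_⟩
      have h1 := (sched A P x).delivered_mono a b (le_of_max_le_left hj)
      have h2 := (sched A P x).sent_mono P a b (le_of_max_le_right hj)
      have h3 := Run.sent_eq_delivered_add (sched_chan_zero A P x) (sched_step A P x) j a b
      have h4 := hlt j
      have he : (sched A P x).event j = .deliver a b := by
        rw [sched_event, hs]
        rcases hc : ((sched A P x).config j).chan a b with _ | ⟨m, rest⟩
        · rw [hc, List.length_nil] at h3
          omega
        · simp [advance, hc]
      rw [Run.delivered_succ, if_pos he]
      omega
  obtain ⟨j, hj⟩ := hgrow ((sched A P x).sent P a b k)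
  exact absurd (hlt j) (not_lt.2 hj)

theorem sched_isFair {l d : ℝ} (hl : 0 < l) (hd : 0 < d) :
    ∃ time, Run.IsFair { sched A P x with time := time } P x l d :=
  exists_isFair hl hd (fun a => (A.start_nonempty a _ (x a)).choose_spec) (sched_chan_zero A P x)
    (sched_step A P x) (sched_task A P x) (sched_message A P x)

end DistributedConsensus

namespace DistributedConsensus

variable {n : ℕ} {X : Type u} {Y : Type v} {G : SimpleGraph (Fin n)}

/-! ### Port numberings exist -/

theorem nonempty_portNumbering (G : SimpleGraph (Fin n)) : Nonempty (PortNumbering G) := by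
  have h : ∀ v, ∃ p : Fin n → ℕ,
      Set.BijOn p (G.neighborSet v) (Set.Iio (G.neighborSet v).ncard) := fun v => by
    have hfin : (G.neighborSet v).Finite := Set.toFinite _
    have hcard : (G.neighborSet v).encard = (Set.Iio (G.neighborSet v).ncard : Set ℕ).encard := by
      rw [← hfin.cast_ncard_eq, ← (Set.finite_Iio _).cast_ncard_eq]
      congr 1
      rw [← Finset.coe_Iio, Set.ncard_coe_finset, Nat.card_Iio]
    exact hfin.exists_bijOn_of_encard_eq hcard
  choose p hp using h
  exact ⟨⟨p, hp⟩⟩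

/-! ### Switching edges -/

/-- Data for replacing the edges `{a, π a}` of a graph by the edges `{a, ψ a}`. -/
structure Switching (G : SimpleGraph (Fin n)) where
  π : Fin n → Fin n
  ψ : Fin n → Fin n
  π_invol : ∀ a, π (π a) = a
  ψ_invol : ∀ a, ψ (ψ a) = a
  fixed : ∀ a, π a = a ↔ ψ a = a
  adj_π : ∀ a, π a ≠ a → G.Adj a (π a)
  not_adj_ψ : ∀ a, ¬ G.Adj a (ψ a)

namespace Switching

variable (S : Switching G)

/-- The node that was behind the port of `a` that leads to `b` after the switch. -/
def perm (a : Fin n) : Equiv.Perm (Fin n) := Equiv.swap (S.π a) (S.ψ a)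

/-- Either `π a` and `ψ a` both equal `a` and nothing changes, or the swap exchanges the neighbour
`π a` with the non-neighbour `ψ a`. -/
theorem adj_perm_iff (a b : Fin n) :
    G.Adj a (S.perm a b) ↔ G.Adj a b ∧ b ≠ S.π a ∨ b = S.ψ a ∧ b ≠ a := by
  have h1 := S.fixed a
  have h2 := S.adj_π a
  have h3 := S.not_adj_ψ a
  unfold perm
  rcases eq_or_ne b (S.π a) with rfl | hπ
  · rw [Equiv.swap_apply_left]
    grind
  · rcases eq_or_ne b (S.ψ a) with rfl | hψ
    · rw [Equiv.swap_apply_right]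
      grind
    · rw [Equiv.swap_apply_of_ne_of_ne hπ hψ]
      grind

/-- The graph in which the edges `{a, π a}` are replaced by the edges `{a, ψ a}`. -/
def graph : SimpleGraph (Fin n) where
  Adj a b := G.Adj a (S.perm a b)
  symm := ⟨fun a b h => by
    rw [adj_perm_iff] at h ⊢
    have h1 := S.π_invol a
    have h2 := S.ψ_invol a
    have h3 := S.π_invol b
    rcases h with ⟨h, hb⟩ | ⟨h, hb⟩
    · exact .inl ⟨h.symm, fun h' => hb (by rw [h', h3])⟩
    · exact .inr ⟨by rw [h, h2], hb.symm⟩⟩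
  loopless := ⟨fun a h => by
    rw [adj_perm_iff] at h
    exact h.elim (fun h => G.irrefl h.1) fun h => h.2 rfl⟩

theorem graph_adj {a b : Fin n} : S.graph.Adj a b ↔ G.Adj a (S.perm a b) := Iff.rfl

theorem neighborSet_graph (a : Fin n) :
    S.graph.neighborSet a = S.perm a ⁻¹' G.neighborSet a := rfl

/-- Degrees must be preserved because a node knows its number of ports from the start; this also
keeps the switched graph dense. -/
theorem ncard_neighborSet_graph (a : Fin n) :
    (S.graph.neighborSet a).ncard = (G.neighborSet a).ncard := by
  rw [neighborSet_graph]
  exact Set.ncard_preimage_of_injective_subset_range (S.perm a).injective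
    (by simp [(S.perm a).surjective.range_eq])

/-- The new edges are attached to the ports of the old edges. -/
def ports (P : PortNumbering G) : PortNumbering S.graph where
  port a b := P.port a (S.perm a b)
  bijOn a := by
    rw [ncard_neighborSet_graph, neighborSet_graph]
    refine (P.bijOn a).comp ⟨fun _ h => h, (S.perm a).injective.injOn, fun b hb => ?_⟩
    exact ⟨(S.perm a).symm b, by simpa using hb, by simp⟩

variable {A : Algorithm.{u, v, w} n X Y} (P : PortNumbering G)

theorem sent_ports (α : Run A) (a b : Fin n) (k : ℕ) :
    α.sent (S.ports P) a b k = α.sent P a (S.perm a b) k := rfl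

theorem totalSent_ports (α : Run A) (k : ℕ) :
    α.totalSent (S.ports P) k = α.totalSent P k := by
  unfold Run.totalSent
  refine Finset.sum_congr rfl fun a _ => ?_
  simp only [sent_ports]
  exact Equiv.sum_comp (S.perm a) fun b => α.sent P a b k

/-- The scheduler does not notice the switch as long as nothing is sent on the switched edges. -/
theorem sched_config_ports (x : Fin n → X) {K : ℕ}
    (hK : ∀ a, (sched A P x).sent P a (S.π a) K = 0) :
    ∀ k ≤ K, (sched A (S.ports P) x).config k = (sched A P x).config k := by
  intro k
  induction k with
  | zero =>
    intro _
    change initialConfig A _ x = initialConfig A _ x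
    simp only [ncard_neighborSet_graph]
  | succ k ih =>
    intro hk
    -- All pairs affected by the switch are silent: those from `π` by assumption, those from `ψ`
    -- because they are not adjacent in `G`.
    have hnone : ∀ a b, b = S.π a ∨ b = S.ψ a → ∀ j ≤ K, (sched A P x).sent P a b j = 0 := by
      rintro a b (rfl | rfl) j hj
      · exact Nat.eq_zero_of_le_zero ((Run.sent_mono _ _ _ _ hj).trans (hK a).le)
      · exact Run.sent_eq_zero_of_not_adj (S.not_adj_ψ a)
    rw [sched_config_succ, sched_config_succ, ih (by omega)]
    set c := (sched A P x).config k with hc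
    rcases ho : slotAt A k with _ | ⟨a, b⟩ | ⟨a, τ⟩
    · rfl
    · rcases hab : c.chan a b with _ | ⟨m, rest⟩
      · simp [advance, hab]
      · have h1 : ¬ (b = S.π a ∨ b = S.ψ a) := fun h => by
          have := Run.chan_eq_nil_of_sent_eq_zero (sched_chan_zero A P x) (sched_step A P x)
            (hnone a b h k (by omega))
          rw [← hc, hab] at this
          exact List.cons_ne_nil _ _ this
        -- The link delivering a message is therefore unaffected, and the receiver sees it at the
        -- same port.
        have h2 : S.perm b a = a := by
          refine Equiv.swap_apply_of_ne_of_ne (fun h => h1 (.inl ?_)) (fun h => h1 (.inr ?_))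
          · rw [h, S.π_invol]
          · rw [h, S.ψ_invol]
        have h3 : (S.ports P).port b a = P.port b a := by
          change P.port b (S.perm b a) = _
          rw [h2]
        simp [advance, hab, h3]
    · rcases hp : A.pick τ (c.state a) with _ | ⟨out, s⟩
      · simp [advance, hp]
      · have he : (sched A P x).event k = .act a τ out := by
          rw [sched_event, ho, ← hc]
          simp [advance, hp]
        have hem : ∀ b, b = S.π a ∨ b = S.ψ a → emitted P a b out = [] := by
          intro b hb
          have := Run.sent_eq_zero_iff.1 (hnone a b hb K le_rfl) k (by omega)
          rcases out with _ | ⟨p, m⟩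
          · rfl
          · refine if_neg fun h => this ⟨τ, p, m, he, h⟩
        have hemS : ∀ b, emitted (S.ports P) a b out = emitted P a b out := by
          intro b
          have : emitted (S.ports P) a b out = emitted P a (S.perm a b) out := by
            rcases out with _ | ⟨p, m⟩ <;> rfl
          rw [this]
          rcases eq_or_ne b (S.π a) with rfl | hπ
          · rw [perm, Equiv.swap_apply_left, hem _ (.inl rfl), hem _ (.inr rfl)]
          · rcases eq_or_ne b (S.ψ a) with rfl | hψ
            · rw [perm, Equiv.swap_apply_right, hem _ (.inl rfl), hem _ (.inr rfl)]
            · rw [perm, Equiv.swap_apply_of_ne_of_ne hπ hψ]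
        simp [advance, hp, hemS]

/-- Messages are counted from events, so equality of configurations must be supplemented by equality
of events. -/
theorem sched_event_ports (x : Fin n → X) {K : ℕ}
    (hK : ∀ a, (sched A P x).sent P a (S.π a) K = 0) {k : ℕ} (hk : k < K) :
    (sched A (S.ports P) x).event k = (sched A P x).event k := by
  rw [sched_event, sched_event, S.sched_config_ports P x hK k hk.le]
  rcases slotAt A k with _ | ⟨a, b⟩ | ⟨a, τ⟩
  · rfl
  · rcases hab : ((sched A P x).config k).chan a b with _ | ⟨m, rest⟩ <;> simp [advance, hab]
  · rcases hp : A.pick τ (((sched A P x).config k).state a) with _ | ⟨out, s⟩ <;>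
      simp [advance, hp]

theorem sched_totalSent_ports (x : Fin n → X) {K : ℕ}
    (hK : ∀ a, (sched A P x).sent P a (S.π a) K = 0) :
    (sched A (S.ports P) x).totalSent (S.ports P) K = (sched A P x).totalSent P K := by
  rw [totalSent_ports]
  unfold Run.totalSent Run.sent
  refine Finset.sum_congr rfl fun a _ => Finset.sum_congr rfl fun b _ => ?_
  congr 1
  ext k
  refine and_congr_right fun hk => ?_
  rw [S.sched_event_ports P x hK hk]

end Switching

end DistributedConsensus

namespace DistributedConsensus

variable {n : ℕ} {X : Type u} {Y : Type v}

/-! ### Two disjoint cliques -/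

/-- The disjoint union of a clique on each of the two sides. -/
def twoCliques (side : Fin n → Bool) : SimpleGraph (Fin n) where
  Adj a b := a ≠ b ∧ side a = side b
  symm := ⟨fun _ _ h => ⟨h.1.symm, h.2.symm⟩⟩
  loopless := ⟨fun _ h => h.1 rfl⟩

variable {side : Fin n → Bool}

theorem twoCliques_adj {a b : Fin n} : (twoCliques side).Adj a b ↔ a ≠ b ∧ side a = side b :=
  Iff.rfl

/-- In a union of two cliques the scheduler produces independent runs on the two sides. -/
theorem sched_twoCliques_congr (A : Algorithm.{u, v, w} n X Y) (P : PortNumbering (twoCliques side))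
    {x x' : Fin n → X} {t : Bool} (hx : ∀ a, side a = t → x a = x' a) (k : ℕ) :
    (∀ a, side a = t →
      ((sched A P x).config k).state a = ((sched A P x').config k).state a) ∧
    ∀ a b, side a = t → side b = t →
      ((sched A P x).config k).chan a b = ((sched A P x').config k).chan a b := by
  induction k with
  | zero =>
    refine ⟨fun a ha => ?_, fun _ _ _ _ => rfl⟩
    change (A.start_nonempty a _ (x a)).choose = (A.start_nonempty a _ (x' a)).choose
    simp only [hx a ha]
  | succ k ih =>
    obtain ⟨ihs, ihc⟩ := ih
    have hcross : ∀ (z : Fin n → X) a b, side a ≠ side b →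
        ((sched A P z).config k).chan a b = [] := fun z a b h =>
      Run.chan_eq_nil_of_sent_eq_zero (sched_chan_zero A P z) (sched_step A P z)
        (Run.sent_eq_zero_of_not_adj fun h' => h h'.2)
    rw [sched_config_succ, sched_config_succ]
    have hc := hcross x
    have hc' := hcross x'
    generalize (sched A P x).config k = c at *
    generalize (sched A P x').config k = c' at *
    rcases slotAt A k with _ | ⟨a, b⟩ | ⟨a, τ⟩
    · exact ⟨ihs, ihc⟩
    · by_cases hab : side a = side b
      · by_cases hb : side b = t
        · have h1 := ihc a b (hab.trans hb) hb
          rcases h : c.chan a b with _ | ⟨m, rest⟩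
          · simpa [advance, h, ← h1] using ⟨ihs, ihc⟩
          · simp only [advance, h, ← h1, ihs b hb]
            refine ⟨fun i hi => ?_, fun i j hi hj => ?_⟩
            · simp only [Function.update_apply]
              split_ifs
              · rfl
              · exact ihs i hi
            · simp only [Function.update_apply]
              split_ifs
              · simp only [Function.update_apply]
                split_ifs
                · rfl
                · exact ihc a j (hab.trans hb) hj
              · exact ihc i j hi hj
        -- A delivery inside the other clique touches neither the states nor the links of side `t`.
        · have key : ∀ e : Config A,
              (∀ i, side i = t → ((advance P e (some (.inl (a, b)))).2).state i = e.state i) ∧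
              ∀ i j, side i = t → side j = t →
                ((advance P e (some (.inl (a, b)))).2).chan i j = e.chan i j := fun e => by
            rcases h : e.chan a b with _ | ⟨m, rest⟩
            · simp [advance, h]
            · simp only [advance, h]
              refine ⟨fun i hi => ?_, fun i j hi hj => ?_⟩
              · rw [Function.update_of_ne (by rintro rfl; exact hb hi)]
              · rw [Function.update_of_ne (by rintro rfl; exact hb (hab.symm.trans hi))]
          refine ⟨fun i hi => ?_, fun i j hi hj => ?_⟩
          · rw [(key c).1 i hi, (key c').1 i hi, ihs i hi]
          · rw [(key c).2 i j hi hj, (key c').2 i j hi hj, ihc i j hi hj]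
      · simpa [advance, hc a b hab, hc' a b hab] using ⟨ihs, ihc⟩
    · by_cases ha : side a = t
      · have h1 := ihs a ha
        rcases h : A.pick τ (c.state a) with _ | ⟨out, s⟩
        · simpa [advance, h, ← h1] using ⟨ihs, ihc⟩
        · simp only [advance, h, ← h1]
          refine ⟨fun i hi => ?_, fun i j hi hj => ?_⟩
          · simp only [Function.update_apply]
            split_ifs
            · rfl
            · exact ihs i hi
          · simp only [Function.update_apply]
            split_ifs
            · simp only [ihc a j ha hj]
            · exact ihc i j hi hj
      · have key : ∀ e : Config A,
            (∀ i, side i = t → ((advance P e (some (.inr (a, τ)))).2).state i = e.state i) ∧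
            ∀ i j, side i = t → side j = t →
              ((advance P e (some (.inr (a, τ)))).2).chan i j = e.chan i j := fun e => by
          rcases h : A.pick τ (e.state a) with _ | ⟨out, s⟩
          · simp [advance, h]
          · simp only [advance, h]
            refine ⟨fun i hi => ?_, fun i j hi hj => ?_⟩
            · rw [Function.update_of_ne (by rintro rfl; exact ha hi)]
            · rw [Function.update_of_ne (by rintro rfl; exact ha hi)]
        refine ⟨fun i hi => ?_, fun i j hi hj => ?_⟩
        · rw [(key c).1 i hi, (key c').1 i hi, ihs i hi]
        · rw [(key c).2 i j hi hj, (key c').2 i j hi hj, ihc i j hi hj]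

/-- Replace an edge `{p t, q t}` of each of the two cliques by the edges `{p t, p !t}` and
`{q t, q !t}`. -/
def cliqueSwitching (p q : Bool → Fin n) (hp : ∀ t, side (p t) = t) (hq : ∀ t, side (q t) = t)
    (hpq : ∀ t, p t ≠ q t) : Switching (twoCliques side) where
  π a := if a = p (side a) then q (side a) else if a = q (side a) then p (side a) else a
  ψ a := if a = p (side a) then p !(side a) else if a = q (side a) then q !(side a) else a
  π_invol a := by grind
  ψ_invol a := by
    have hqp : ∀ t, q t ≠ p t := fun t => (hpq t).symm
    by_cases h₁ : ∃ t, a = p t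
    · obtain ⟨t, rfl⟩ := h₁
      simp [hp]
    · by_cases h₂ : ∃ t, a = q t
      · obtain ⟨t, rfl⟩ := h₂
        simp [hq, hqp]
      · push Not at h₁ h₂
        simp [h₁, h₂]
  fixed a := by grind
  adj_π a h := by
    rw [twoCliques_adj]
    grind
  not_adj_ψ a := by
    rw [twoCliques_adj]
    grind

/-! ### Degrees, connectivity and density of the switched cliques -/

section

variable (p q : Bool → Fin n) (hp : ∀ t, side (p t) = t) (hq : ∀ t, side (q t) = t)
    (hpq : ∀ t, p t ≠ q t)

theorem ncard_neighborSet_twoCliques (a : Fin n) :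
    ((twoCliques side).neighborSet a).ncard + 1 =
      (Finset.univ.filter fun b => side b = side a).card := by
  classical
  have h : (twoCliques side).neighborSet a =
      ((Finset.univ.filter fun b => side b = side a).erase a : Finset (Fin n)) := by
    ext b
    simp [twoCliques_adj, eq_comm, and_comm]
  rw [h, Set.ncard_coe_finset, Finset.card_erase_add_one (by simp)]

theorem le_ncard_edgeSet_of_degrees {G : SimpleGraph (Fin n)} {δ : ℕ}
    (h : ∀ a, δ ≤ (G.neighborSet a).ncard) : n * δ ≤ 2 * G.edgeSet.ncard := by
  classical
  have h1 := G.sum_degrees_eq_twice_card_edges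
  have h2 : G.edgeSet.ncard = G.edgeFinset.card := by
    rw [← SimpleGraph.coe_edgeFinset, Set.ncard_coe_finset]
  rw [h2, ← h1]
  have h3 : ∑ _a : Fin n, δ ≤ ∑ a, G.degree a := Finset.sum_le_sum fun a _ => by
    have := h a
    rwa [← SimpleGraph.coe_neighborFinset, Set.ncard_coe_finset,
      SimpleGraph.card_neighborFinset_eq_degree] at this
  simpa using h3

/-- A removed edge is bypassed through a third node of its clique, and the new edge between `p true`
and `p false` joins the two sides. -/
theorem connected_cliqueSwitching
    (hcard : ∀ t, 3 ≤ (Finset.univ.filter fun b => side b = t).card) :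
    (cliqueSwitching p q hp hq hpq).graph.Connected := by
  set S := cliqueSwitching p q hp hq hpq with hS
  have hπ : ∀ a, S.π a =
      if a = p (side a) then q (side a) else if a = q (side a) then p (side a) else a :=
    fun _ => rfl
  have hψ : ∀ t, S.ψ (p t) = p !t := fun t => by
    change (if _ then _ else _) = _
    rw [hp, if_pos rfl]
  have hsame : ∀ a b, side a = side b → S.graph.Reachable a b := by
    intro a b hab
    by_cases hne : a = b
    · rw [hne]
    by_cases hb : b = S.π a
    · obtain ⟨c, hc, hca, hcb⟩ : ∃ c, side c = side a ∧ c ≠ a ∧ c ≠ b := by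
        by_contra! hno
        have : (Finset.univ.filter fun c => side c = side a) ⊆ {a, b} := fun c hc => by
          have := hno c (by simpa using hc)
          simp only [Finset.mem_insert, Finset.mem_singleton]
          tauto
        have := (Finset.card_le_card this).trans Finset.card_le_two
        have := hcard (side a)
        omega
      have h1 : S.graph.Adj a c := by
        rw [S.graph_adj, S.adj_perm_iff]
        exact .inl ⟨⟨hca.symm, hc.symm⟩, by rw [← hb]; exact hcb⟩
      have h2 : S.graph.Adj b c := by
        rw [S.graph_adj, S.adj_perm_iff]
        refine .inl ⟨⟨hcb.symm, by rw [hc, hab]⟩, ?_⟩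
        rw [hb, S.π_invol]
        exact hca
      exact h1.reachable.trans h2.reachable.symm
    · refine SimpleGraph.Adj.reachable ?_
      rw [S.graph_adj, S.adj_perm_iff]
      exact .inl ⟨⟨hne, hab⟩, hb⟩
  have hcross : S.graph.Reachable (p true) (p false) := by
    refine SimpleGraph.Adj.reachable ?_
    rw [S.graph_adj, S.adj_perm_iff]
    refine .inr ⟨(hψ true).symm, fun h => ?_⟩
    have := congrArg side h
    simp [hp] at this
  have hall : ∀ a, S.graph.Reachable a (p true) := fun a => by
    rcases h : side a with _ | _
    · exact (hsame a (p false) (by rw [h, hp])).trans hcross.symm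
    · exact hsame a (p true) (by rw [h, hp])
  have : Nonempty (Fin n) := ⟨p true⟩
  exact ⟨fun a b => (hall a).trans (hall b).symm⟩

/-- Every degree is at least `(n - 3) / 2`, as in the cliques, so there are at least `n (n - 3) / 4
≥ n log n` edges. -/
theorem cliqueSwitching_mem_denseGraphs (hn : 7 ≤ n) (hlog : 4 * Real.log n ≤ n - 3)
    (hcard : ∀ t, n ≤ 2 * (Finset.univ.filter fun b => side b = t).card + 1) :
    (cliqueSwitching p q hp hq hpq).graph ∈ denseGraphs n := by
  refine ⟨connected_cliqueSwitching p q hp hq hpq fun t => ?_, ?_⟩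
  · have := hcard t
    omega
  · have h := le_ncard_edgeSet_of_degrees (G := (cliqueSwitching p q hp hq hpq).graph)
      (δ := (n - 2) / 2) fun a => by
        rw [Switching.ncard_neighborSet_graph]
        have h1 := ncard_neighborSet_twoCliques (side := side) a
        have h2 := hcard (side a)
        omega
    have h3 : (n : ℝ) ≤ 2 * ((n - 2) / 2 : ℕ) + 3 := by
      have : n ≤ 2 * ((n - 2) / 2) + 3 := by omega
      exact_mod_cast this
    have h4 : (n : ℝ) * ((n - 2) / 2 : ℕ) ≤
        2 * ((cliqueSwitching p q hp hq hpq).graph.edgeSet.ncard : ℝ) := by exact_mod_cast h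
    have h5 : (0 : ℝ) ≤ n := Nat.cast_nonneg n
    nlinarith

theorem sent_cliqueSwitching_eq_zero {A : Algorithm.{u, v, w} n X Y} {α : Run A}
    {P : PortNumbering (twoCliques side)} {K : ℕ}
    (h : ∀ t, α.sent P (p t) (q t) K = 0 ∧ α.sent P (q t) (p t) K = 0) (a : Fin n) :
    α.sent P a ((cliqueSwitching p q hp hq hpq).π a) K = 0 := by
  change α.sent P a (if _ then _ else _) K = 0
  split_ifs with h1 h2
  · have := (h (side a)).1
    rwa [← h1] at this
  · have := (h (side a)).2
    rwa [← h2] at this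
  · exact Run.sent_eq_zero_of_not_adj fun h => h.1 rfl

end

/-! ### The lower bound -/

/-- At least one message has been sent over every edge of the clique on the side `t`. -/
def Covered {A : Algorithm.{u, v, w} n X Y} (α : Run A) (P : PortNumbering (twoCliques side))
    (t : Bool) (k : ℕ) : Prop :=
  ∀ a b, a ≠ b → side a = t → side b = t → α.sent P a b k ≠ 0 ∨ α.sent P b a k ≠ 0

/-- If every edge between nodes of a set of size at least `m` is used, then there are at least
`m (m - 1) / 2` messages. -/
theorem mul_le_two_mul_totalSent {G : SimpleGraph (Fin n)} {A : Algorithm.{u, v, w} n X Y}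
    {α : Run A} {P : PortNumbering G} {k : ℕ} (s : Finset (Fin n))
    (h : ∀ a ∈ s, ∀ b ∈ s, a ≠ b → α.sent P a b k ≠ 0 ∨ α.sent P b a k ≠ 0) :
    s.card * (s.card - 1) ≤ 2 * α.totalSent P k := by
  have h1 : ∑ a ∈ s, ∑ b ∈ s, (α.sent P a b k + α.sent P b a k) ≤ 2 * α.totalSent P k := by
    have hle : ∑ a ∈ s, ∑ b ∈ s, α.sent P a b k ≤ α.totalSent P k :=
      (Finset.sum_le_sum fun a _ => Finset.sum_le_sum_of_subset (Finset.subset_univ s)).trans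
        (Finset.sum_le_sum_of_subset (Finset.subset_univ s))
    have hcomm : ∑ a ∈ s, ∑ b ∈ s, α.sent P b a k = ∑ a ∈ s, ∑ b ∈ s, α.sent P a b k :=
      Finset.sum_comm
    simp only [Finset.sum_add_distrib, hcomm]
    omega
  refine le_trans ?_ h1
  rw [← smul_eq_mul]
  refine Finset.card_nsmul_le_sum _ _ _ fun a ha => ?_
  rw [← Finset.card_erase_of_mem ha, Finset.card_eq_sum_ones]
  refine le_trans (Finset.sum_le_sum fun b hb => ?_)
    (Finset.sum_le_sum_of_subset (Finset.erase_subset a s))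
  have := h a ha b (Finset.mem_of_mem_erase hb) (Finset.ne_of_mem_erase hb).symm
  omega

/-- Just before the first clique is covered, many messages have been sent, some edge of each clique
is unused, and some node is active. -/
theorem exists_many_of_covered {A : Algorithm.{u, v, w} n X Y}
    {P : PortNumbering (twoCliques side)} {x : Fin n → X}
    (hcard : ∀ t, n ≤ 2 * (Finset.univ.filter fun b => side b = t).card + 1) (hn : 7 ≤ n)
    (h : ∃ k t, Covered (sched A P x) P t k) :
    ∃ K, (∀ t, ¬ Covered (sched A P x) P t K) ∧
      (∀ j ≤ K, ¬ AllStopped ((sched A P x).config j)) ∧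
      (n - 3) * (n - 5) / 8 ≤ (sched A P x).totalSent P K := by
  classical
  obtain ⟨t, ht⟩ := Nat.find_spec h
  have hmin := fun j => Nat.find_min h (m := j)
  generalize Nat.find h = k at ht hmin
  have hcardt := hcard t
  obtain _ | K := k
  · have h1 : 1 < (Finset.univ.filter fun b => side b = t).card := by omega
    obtain ⟨a, ha, b, hb, hab⟩ := Finset.one_lt_card.1 h1
    have := ht a b hab (by simpa using ha) (by simpa using hb)
    simp [Run.sent_zero] at this
  have hK : ∀ t, ¬ Covered (sched A P x) P t K := fun t' h' => hmin K (Nat.lt_succ_self K) ⟨t', h'⟩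
  -- Coverage first occurs at `K + 1`, so event `K` sends a message; its sender `a` is still active
  -- at `K`, hence at all earlier times.
  have hsend : ∃ a b, ((sched A P x).event K).Sends P a b := by
    by_contra! hno
    refine hK t fun a b hab ha hb => ?_
    have := ht a b hab ha hb
    simpa only [Run.sent_succ, hno, if_false, add_zero] using this
  obtain ⟨a, b, τ, p, m, he, -⟩ := hsend
  refine ⟨K, hK, fun j hj hdone => ?_, ?_⟩
  · obtain ⟨y, hy⟩ := Option.isSome_iff_exists.1 (hdone a)
    have hy' := Run.result_mono (sched_step A P x) hj hy
    have hst := sched_step A P x K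
    rw [he] at hst
    obtain ⟨s, hs, -⟩ := hst
    exact A.step_of_stopped _ _ _ _ (by simp [hy']) hs
  -- Event `K` sends only from `a`, so edges avoiding `a` were already used by time `K`. At least
  -- `(n - 3) / 2` nodes of the clique remain.
  · set s := (Finset.univ.filter fun b => side b = t).erase a with hs
    have h1 : s.card * (s.card - 1) ≤ 2 * (sched A P x).totalSent P K := by
      refine mul_le_two_mul_totalSent s fun i hi j hj hij => ?_
      simp only [hs, Finset.mem_erase, Finset.mem_filter, Finset.mem_univ, true_and] at hi hj
      have hno : ∀ i j, i ≠ a → ¬ ((sched A P x).event K).Sends P i j := by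
        rintro i j hi ⟨τ', p', m', he', -⟩
        rw [he] at he'
        injection he' with h1
        exact hi h1.symm
      have := ht i j hij hi.2 hj.2
      simpa only [Run.sent_succ, hno i j hi.1, hno j i hj.1, if_false, add_zero] using this
    have h2 : n ≤ 2 * s.card + 3 := by
      have : (Finset.univ.filter fun b => side b = t).card - 1 ≤ s.card :=
        Finset.pred_card_le_card_erase
      omega
    have h3 : (n - 3) * (n - 5) ≤ (2 * s.card) * (2 * (s.card - 1)) :=
      Nat.mul_le_mul (by omega) (by omega)
    have h4 : (2 * s.card) * (2 * (s.card - 1)) = 4 * (s.card * (s.card - 1)) := by ring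
    omega

theorem exists_unused_of_not_covered {A : Algorithm.{u, v, w} n X Y} {α : Run A}
    {P : PortNumbering (twoCliques side)} {K : ℕ} (h : ∀ t, ¬ Covered α P t K) :
    ∃ p q : Bool → Fin n, (∀ t, side (p t) = t) ∧ (∀ t, side (q t) = t) ∧ (∀ t, p t ≠ q t) ∧
      ∀ t, α.sent P (p t) (q t) K = 0 ∧ α.sent P (q t) (p t) K = 0 := by
  unfold Covered at h
  push Not at h
  choose p q hpq hp hq h using h
  exact ⟨p, q, hp, hq, hpq, h⟩

/-- If no clique is ever covered, then one edge in each of them is never used. -/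
theorem exists_never_used {A : Algorithm.{u, v, w} n X Y} {α : Run A}
    {P : PortNumbering (twoCliques side)} (h : ∀ k t, ¬ Covered α P t k) :
    ∃ p q : Bool → Fin n, (∀ t, side (p t) = t) ∧ (∀ t, side (q t) = t) ∧ (∀ t, p t ≠ q t) ∧
      ∀ k t, α.sent P (p t) (q t) k = 0 ∧ α.sent P (q t) (p t) k = 0 := by
  choose p q hp hq hpq hk using fun k => exists_unused_of_not_covered (h k)
  -- Unused edges could vary with time, but there are finitely many choices, so one recurs at
  -- arbitrarily late times; by monotonicity of `sent` it is unused throughout.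
  obtain ⟨⟨p', q'⟩, hinf⟩ := Finite.exists_infinite_fiber fun k => (p k, q k)
  rw [Set.infinite_coe_iff] at hinf
  obtain ⟨k₀, hk₀⟩ := hinf.nonempty
  obtain ⟨rfl, rfl⟩ : p k₀ = p' ∧ q k₀ = q' := by simpa using hk₀
  refine ⟨p k₀, q k₀, hp k₀, hq k₀, hpq k₀, fun k t => ?_⟩
  obtain ⟨j, hj, hkj⟩ := hinf.exists_gt k
  obtain ⟨h1, h2⟩ : p j = p k₀ ∧ q j = q k₀ := by simpa using hj
  have h3 := hk j t
  rw [h1, h2] at h3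
  exact ⟨Nat.eq_zero_of_le_zero ((α.sent_mono P _ _ hkj.le).trans h3.1.le),
    Nat.eq_zero_of_le_zero ((α.sent_mono P _ _ hkj.le).trans h3.2.le)⟩

theorem exists_covered_of_computes [Nonempty X] {A : Algorithm.{u, v, w} n X Y} {l d : ℝ}
    (hl : 0 < l) (hd : 0 < d) {f : (Fin n → X) → Y} (hf : IsConsensus f)
    (hA : Computes A l d f (denseGraphs n)) (P : PortNumbering (twoCliques side))
    (hcard : ∀ t, n ≤ 2 * (Finset.univ.filter fun b => side b = t).card + 1) (hn : 7 ≤ n)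
    (hlog : 4 * Real.log n ≤ n - 3) :
    ∃ x, ∃ k t, Covered (sched A P x) P t k := by
  by_contra! hno
  -- The disconnected graph itself is not covered by `hA`; its outputs are read off from the
  -- switched graph, whose run agrees with it at all times. The switch may depend on `x`.
  have hout : ∀ x, ∃ k, ∀ a, A.result (((sched A P x).config k).state a) = some (f x) := by
    intro x
    obtain ⟨p, q, hp, hq, hpq, h⟩ := exists_never_used (hno x)
    set S := cliqueSwitching p q hp hq hpq
    obtain ⟨time, hfair⟩ := sched_isFair A (S.ports P) x hl hd
    obtain ⟨R, hR⟩ := hA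
    obtain ⟨k, -, hk⟩ := hR _ (cliqueSwitching_mem_denseGraphs p q hp hq hpq hn hlog hcard)
      _ _ _ hfair
    have hk : ∀ a, A.result (((sched A (S.ports P) x).config k).state a) = some (f x) := hk
    rw [S.sched_config_ports P x
      (fun a => sent_cliqueSwitching_eq_zero p q hp hq hpq (h k) a) k le_rfl] at hk
    exact ⟨k, hk⟩
  have hcongr : ∀ t x x', (∀ a, side a = t → x a = x' a) → f x = f x' := by
    intro t x x' hx
    obtain ⟨k, hk⟩ := hout x
    obtain ⟨k', hk'⟩ := hout x'
    have hpos : 0 < (Finset.univ.filter fun b => side b = t).card := by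
      have := hcard t
      omega
    obtain ⟨a, ha⟩ := Finset.card_pos.1 hpos
    have h1 := Run.result_mono (sched_step A P x) (le_max_left k k') (hk a)
    have h2 := Run.result_mono (sched_step A P x') (le_max_right k k') (hk' a)
    rw [(sched_twoCliques_congr A P hx _).1 a (by simpa using ha), h2] at h1
    exact (Option.some.inj h1).symm
  obtain ⟨x₀⟩ : Nonempty (Fin n → X) := inferInstance
  let i : Fin n := ⟨0, by omega⟩
  obtain ⟨y, z, hyz⟩ := hf x₀ i
  -- Seen from the side not containing `i`, changing the argument `i` is invisible.
  refine hyz (hcongr (!side i) _ _ fun a ha => ?_)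
  have hai : a ≠ i := by
    rintro rfl
    simp at ha
  rw [Function.update_of_ne hai, Function.update_of_ne hai]

theorem exists_side (n : ℕ) : ∃ side : Fin n → Bool,
    ∀ t, n ≤ 2 * (Finset.univ.filter fun b => side b = t).card + 1 := by
  refine ⟨fun i => decide (i.val < n / 2), fun t => ?_⟩
  have h1 : (Finset.univ.filter fun i : Fin n => i.val < n / 2).card = n / 2 := by
    rw [Fin.card_filter_val_lt]
    omega
  have h2 := Finset.card_filter_add_card_filter_not (s := (Finset.univ : Finset (Fin n)))
    fun i => i.val < n / 2
  rw [Finset.card_univ, Fintype.card_fin, h1] at h2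
  rcases t with _ | _
  · simp only [decide_eq_false_iff_not]
    omega
  · simp only [decide_eq_true_eq, h1]
    omega

/-- Every algorithm for a consensus function sends quadratically many messages in some execution
in some dense network. -/
theorem le_messageComplexity [Nonempty X] {l d : ℝ} (hl : 0 < l) (hd : 0 < d)
    {f : (Fin n → X) → Y} (hf : IsConsensus f) (hn : 7 ≤ n) (hlog : 4 * Real.log n ≤ n - 3) :
    (((n - 3) * (n - 5) / 8 : ℕ) : ℕ∞) ≤
      messageComplexity.{u, v, w} l d f (denseGraphs n) := by
  refine le_iInf₂ fun A hA => ?_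
  obtain ⟨side, hcard⟩ := exists_side n
  obtain ⟨P⟩ := nonempty_portNumbering (twoCliques side)
  obtain ⟨x, hx⟩ := exists_covered_of_computes hl hd hf hA P hcard hn hlog
  obtain ⟨K, hK, hrun, hmany⟩ := exists_many_of_covered hcard hn hx
  obtain ⟨p, q, hp, hq, hpq, h⟩ := exists_unused_of_not_covered hK
  set S := cliqueSwitching p q hp hq hpq
  have hS := sent_cliqueSwitching_eq_zero p q hp hq hpq h
  obtain ⟨time, hfair⟩ := sched_isFair A (S.ports P) x hl hd
  refine le_iSup₂_of_le S.graph (cliqueSwitching_mem_denseGraphs p q hp hq hpq hn hlog hcard)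
    (le_iSup₂_of_le (S.ports P) x (le_iSup₂_of_le _ hfair ?_))
  refine le_iSup₂_of_le
    (f := fun k _ => (((sched A (S.ports P) x).totalSent (S.ports P) k : ℕ) : ℕ∞)) K (fun j hj => ?_) ?_
  · change ¬ AllStopped ((sched A (S.ports P) x).config j)
    rw [S.sched_config_ports P x hS j hj.le]
    exact hrun j hj.le
  · rw [S.sched_totalSent_ports P x hS]
    exact_mod_cast hmany

/-! ### Numerical estimates and conclusion -/

theorem eventually_four_mul_log_le :
    ∀ᶠ n : ℕ in Filter.atTop, 4 * Real.log n ≤ (n : ℝ) - 3 := by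
  -- With `log n ≤ n / 8`, the left side is at most `n / 2`, which is at most `n - 3` once `n ≥ 6`.
  have h := (Real.isLittleO_log_id_atTop.bound (show (0 : ℝ) < 1 / 8 by norm_num)).natCast_atTop
  filter_upwards [h, Filter.eventually_ge_atTop 6] with n hn h6
  have h6' : (6 : ℝ) ≤ n := by exact_mod_cast h6
  have h1 := (le_abs_self _).trans hn
  simp only [id, Real.norm_eq_abs, Nat.abs_cast] at h1
  linarith

theorem two_mul_ncard_edgeSet_le (G : SimpleGraph (Fin n)) : 2 * G.edgeSet.ncard ≤ n * n := by
  classical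
  have h1 := G.sum_degrees_eq_twice_card_edges
  have h2 : G.edgeSet.ncard = G.edgeFinset.card := by
    rw [← SimpleGraph.coe_edgeFinset, Set.ncard_coe_finset]
  rw [h2, ← h1]
  have h3 : ∑ a, G.degree a ≤ ∑ _a : Fin n, n := Finset.sum_le_sum fun a _ => by
    simpa using (G.degree_lt_card_verts a).le
  simpa using h3

end DistributedConsensus

theorem proposition2 :
    ∃ c : ℝ≥0, 0 < c ∧ ∃ N : ℕ, ∀ n : ℕ, N ≤ n →
      ∀ (X : Type u) [LinearOrder X] [Nonempty X] (Y : Type v) (f : (Fin n → X) → Y),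
        DistributedConsensus.IsLocallySensitive f ∨ DistributedConsensus.IsExtractive f →
        ∀ l d : ℝ, 0 < l → 0 < d →
        ∀ G ∈ DistributedConsensus.denseGraphs n,
          (c : ℝ≥0∞) * (G.edgeSet.ncard : ℝ≥0∞) ≤
            ((DistributedConsensus.messageComplexity.{u, v, w} l d f
              (DistributedConsensus.denseGraphs n) : ℕ∞) : ℝ≥0∞) := by
  obtain ⟨N, hN⟩ := Filter.eventually_atTop.1 DistributedConsensus.eventually_four_mul_log_le
  -- The message bound is about `n ^ 2 / 8` and `|E| ≤ n ^ 2 / 2`, so any constant below `1 / 4`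
  -- works for large `n`; `1 / 16` with `n ≥ 20` leaves room for the lower-order terms and the
  -- rounding.
  refine ⟨1 / 16, by norm_num, max N 20, fun n hn X _ _ Y f hf l d hl hd G _ => ?_⟩
  have hn20 : 20 ≤ n := le_of_max_le_right hn
  have hbound := DistributedConsensus.le_messageComplexity.{u, v, w} hl hd
    (hf.elim And.left And.left) (by omega) (hN n (le_of_max_le_left hn))
  have hE := DistributedConsensus.two_mul_ncard_edgeSet_le G
  have hnat : G.edgeSet.ncard ≤ 16 * ((n - 3) * (n - 5) / 8) := by
    obtain ⟨m, rfl⟩ := Nat.exists_eq_add_of_le hn20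
    have h1 : (20 + m - 3) * (20 + m - 5) = m * m + 32 * m + 255 := by
      rw [show 20 + m - 3 = m + 17 by omega, show 20 + m - 5 = m + 15 by omega]
      ring
    have h2 : (20 + m) * (20 + m) = m * m + 40 * m + 400 := by ring
    rw [h1]
    rw [h2] at hE
    generalize m * m = q at *
    omega
  have hreal : (1 / 16 : ℝ≥0) * (G.edgeSet.ncard : ℝ≥0) ≤ (((n - 3) * (n - 5) / 8 : ℕ) : ℝ≥0) := by
    have : (G.edgeSet.ncard : ℝ≥0) ≤ 16 * (((n - 3) * (n - 5) / 8 : ℕ) : ℝ≥0) := by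
      exact_mod_cast hnat
    rw [one_div, inv_mul_le_iff₀ (by norm_num)]
    exact this
  calc ((1 / 16 : ℝ≥0) : ℝ≥0∞) * (G.edgeSet.ncard : ℝ≥0∞)
      ≤ (((n - 3) * (n - 5) / 8 : ℕ) : ℝ≥0∞) := by exact_mod_cast hreal
    _ = (((((n - 3) * (n - 5) / 8 : ℕ) : ℕ∞)) : ℝ≥0∞) := by simp
    _ ≤ _ := ENat.toENNReal_le.2 hbound
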